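/- **DSS-WL with node marking.** All graphs are finite, simple and undirected. Let $\mathcal C$ be a set of colors, $c_0\ne c_1$ two colors in $\mathcal C$, and let $\operatorname{hash}$ be an injective function with values in $\mathcal C$ which is defined on all finite multisets of colors and on all 4-tuples (color, finite multiset of colors, color, finite multiset of colors). For a graph $G=(\mathcal V_G,\mathcal E_G)$ with neighborhoods $\mathcal N_G(v)$ define, for $u,v\in\mathcal V_G$ and $t\ge 0$, $\chi_{G,u}^0(v)=c_1$ if $v=u$ and $\chi_{G,u}^0(v)=c_0$ otherwise, $$\chi_G^t(v)=\operatorname{hash}\big(\{\!\{\chi_{G,u}^t(v):u\in\mathcal V_G\}\!\}\big),$$ $$\chi_{G,u}^{t+1}(v)=\operatorname{hash}\big(\chi_{G,u}^{t}(v),\{\!\{\chi_{G,u}^{t}(w):w\in\mathcal N_G(v)\}\!\},\chi_G^{t}(v),\{\!\{\chi_G^{t}(w):w\in\mathcal N_G(v)\}\!\}\big).$$ For two graphs $G$ and $H$, call $T$ *stable* if the partition of the disjoint union $(\mathcal V_G\times\mathcal V_G)\sqcup(\mathcal V_H\times\mathcal V_H)$ into classes of equal color $\chi_{G,u}^T(v)$,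 resp. $\chi_{H,u}^T(v)$, is not refined when $T$ is replaced by $T+1$. A vertex (an edge) of a graph is a *cut vertex* (a *cut edge*) if removing it increases the number of connected components. **Theorem 3.2.** Let $G=(\mathcal V_G,\mathcal E_G)$ and $H=(\mathcal V_H,\mathcal E_H)$ be two graphs. All sufficiently large $T$ are stable. For every stable $T$, the color mappings $\chi_G=\chi_G^T$ and $\chi_H=\chi_H^T$ of DSS-WL with node marking policy satisfy: 1. For any two nodes $w\in\mathcal V_G$ and $x\in\mathcal V_H$, if $\chi_G(w)=\chi_H(x)$, then $w$ is a cut vertex of $G$ if and only if $x$ is a cut vertex of $H$. 2. For any two edges $\{w_1,w_2\}\in\mathcal E_G$ and $\{x_1,x_2\}\in\mathcal E_H$, if $\{\!\{\chi_G(w_1),\chi_G(w_2)\}\!\}=\{\!\{\chi_H(x_1),\chi_H(x_2)\}\!\}$, then $\{w_1,w_2\}$ is a cut edge of $G$ if and only if $\{x_1,x_2\}$ is a cut edge of $H$. -/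

import Mathlib

/-- `v` is a cut vertex of `G`: removing `v` (that is, passing to the subgraph induced on the
other vertices) increases the number of connected components. -/
def IsCutVertex {V : Type*} (G : SimpleGraph V) (v : V) : Prop :=
  Nat.card G.ConnectedComponent < Nat.card (G.induce ({v}ᶜ : Set V)).ConnectedComponent

/-- `e` is a cut edge of `G`: removing `e` (and keeping all vertices) increases the number of
connected components. -/
def IsCutEdge {V : Type*} (G : SimpleGraph V) (e : Sym2 V) : Prop :=
  Nat.card G.ConnectedComponent < Nat.card (G.deleteEdges {e}).ConnectedComponent

/-- The two kinds of objects which DSS-WL hashes: a multiset of colors, and a 4-tuple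
(color, multiset of colors, color, multiset of colors). -/
inductive HashArg (C : Type*) : Type _
  | multiset (m : Multiset C) : HashArg C
  | tuple (own : C) (ownNbrs : Multiset C) (glob : C) (globNbrs : Multiset C) : HashArg C

/-- A bag of graphs `G_i` on the common vertex set `V`, each with an initial coloring. -/
structure GraphBag (V C ι : Type*) where
  graph : ι → SimpleGraph V
  init : ι → V → C

open Classical in
/-- The node marking policy: the bag has one copy `G_u = G` of the graph for each node `u`, and
in `G_u` the initial color of `u` is `c₁` while all other nodes have initial color `c₀`. -/
noncomputable def nodeMarking {V C : Type*} (c₀ c₁ : C) (G : SimpleGraph V) : GraphBag V C V where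
  graph _ := G
  init u v := if v = u then c₁ else c₀

open Classical in
/-- The multiset of the colors `χ u`, where `u` runs over the neighbors of `v` in `G`. -/
noncomputable def nbrColors {V C : Type*} [Fintype V] (G : SimpleGraph V) (χ : V → C) (v : V) :
    Multiset C :=
  (Finset.univ.filter fun u => G.Adj v u).val.map χ

/-- Aggregation across all graphs of the bag: `χ_G(v) = hash {{χ_{G_i}(v) : i}}`. -/
def bagColor {V C ι : Type*} [Fintype ι] (hash : HashArg C → C) (χ : ι → V → C) (v : V) : C :=
  hash (HashArg.multiset (Finset.univ.val.map fun i => χ i v))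

/-- The DSS-WL color `χ_{G_i}^t(v)` of the node `v` in the graph `G_i` after `t` iterations. -/
noncomputable def dssSubColor {V C ι : Type*} [Fintype V] [Fintype ι] (hash : HashArg C → C)
    (G : SimpleGraph V) (B : GraphBag V C ι) : ℕ → ι → V → C
  | 0 => B.init
  | t + 1 => fun i v =>
      hash (HashArg.tuple
        (dssSubColor hash G B t i v)
        (nbrColors (B.graph i) (dssSubColor hash G B t i) v)
        (bagColor hash (dssSubColor hash G B t) v)
        (nbrColors G (bagColor hash (dssSubColor hash G B t)) v))

/-- The DSS-WL color `χ_G^t(v)` of the node `v` of `G` after `t` iterations. -/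
noncomputable def dssColor {V C ι : Type*} [Fintype V] [Fintype ι] (hash : HashArg C → C)
    (G : SimpleGraph V) (B : GraphBag V C ι) (t : ℕ) (v : V) : C :=
  bagColor hash (dssSubColor hash G B t) v

/-- The coloring obtained by running DSS-WL with the bag `A` on `G` and with the bag `B` on `H`
for `t` iterations: it colors the pairs (index of a graph in a bag, node) of both runs. -/
noncomputable def dssJointColor {V W C ι κ : Type*} [Fintype V] [Fintype W] [Fintype ι] [Fintype κ]
    (hash : HashArg C → C) (G : SimpleGraph V) (A : GraphBag V C ι)
    (H : SimpleGraph W) (B : GraphBag W C κ) (t : ℕ) : (ι × V) ⊕ (κ × W) → C :=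
  Sum.elim (fun p => dssSubColor hash G A t p.1 p.2) (fun p => dssSubColor hash H B t p.1 p.2)

/-- After `t` iterations DSS-WL is stable on the two inputs: the partition into color classes
(taken jointly, since the colors of the two graphs are going to be compared) is not refined by
the next iteration. -/
def DSSStable {V W C ι κ : Type*} [Fintype V] [Fintype W] [Fintype ι] [Fintype κ]
    (hash : HashArg C → C) (G : SimpleGraph V) (A : GraphBag V C ι)
    (H : SimpleGraph W) (B : GraphBag W C κ) (t : ℕ) : Prop :=
  ∀ p q, dssJointColor hash G A H B t p = dssJointColor hash G A H B t q →
    dssJointColor hash G A H B (t + 1) p = dssJointColor hash G A H B (t + 1) q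

open SimpleGraph Relation

/-! Stable colors form a fixed point, and `StableColoring` lists the properties needed. Walks ending
at the marked node lift between equally colored pairs, so the color of a node fixes its distances to
the nodes of each color. Extremal distances then show that a cut has a side poor in colors: at a cut
vertex `w` some side has no node colored like `w` (`forall_ne_or_forall_ne`); at a cut edge some
side has no node colored like the opposite end, except perhaps its own end
(`forall_eq_or_forall_eq`). Mark the node of that side at the cut. Its neighbor across (`w`, or the
opposite end) is its only neighbor of that color, so a walk in `H` avoiding the corresponding vertex
or edge lifts to a walk in `G` confined to the side. Hence `H` is cut there too. -/

/-- Colorings `c u v`, `d u' v'` of the pairs of nodes of `G` and `H` (`u` is the marked node) and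
`A v`, `B v'` of the nodes which cannot be refined further by exchanging messages. -/
structure StableColoring {V W C : Type*} (G : SimpleGraph V) (H : SimpleGraph W)
    (c : V → V → C) (d : W → W → C) (A : V → C) (B : W → C) : Prop where
  mark : ∀ {u v u' v'}, c u v = d u' v' → (v = u ↔ v' = u')
  glob : ∀ {u v u' v'}, c u v = d u' v' → A v = B v'
  lift : ∀ {u v u' v' w}, c u v = d u' v' → G.Adj v w → ∃ w', H.Adj v' w' ∧ c u w = d u' w'
  row : ∀ {v v'}, A v = B v' → ∀ u, ∃ u', c u v = d u' v'
  uniq : ∀ {u v u' v' k}, c u v = d u' v' →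
    (∀ w₁ w₂, G.Adj v w₁ → G.Adj v w₂ → A w₁ = k → A w₂ = k → w₁ = w₂) →
    ∀ w₁ w₂, H.Adj v' w₁ → H.Adj v' w₂ → B w₁ = k → B w₂ = k → w₁ = w₂

/-! ### Connectivity after removing a vertex or an edge -/

/-- `v` can be reached from `u` by a walk which does not visit `w` after its start. -/
def AvoidReach {V : Type*} (G : SimpleGraph V) (w u v : V) : Prop :=
  ReflTransGen (fun a b => G.Adj a b ∧ b ≠ w) u v

theorem AvoidReach.ne {V : Type*} {G : SimpleGraph V} {w u v : V} (h : AvoidReach G w u v)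
    (hu : u ≠ w) : v ≠ w := by
  induction h with
  | refl => exact hu
  | tail _ h _ => exact h.2

theorem AvoidReach.symm {V : Type*} {G : SimpleGraph V} {w u v : V} (h : AvoidReach G w u v)
    (hu : u ≠ w) : AvoidReach G w v u := by
  induction h with
  | refl => exact .refl
  | tail h₁ h₂ ih => exact .head ⟨h₂.1.symm, AvoidReach.ne h₁ hu⟩ ih

theorem AvoidReach.reachable {V : Type*} {G : SimpleGraph V} {w u v : V}
    (h : AvoidReach G w u v) : G.Reachable u v := by
  induction h with
  | refl => exact .rfl
  | tail _ h ih => exact ih.trans h.1.reachable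

theorem reachable_induce_iff {V : Type*} {G : SimpleGraph V} {w : V} (u v : ({w}ᶜ : Set V)) :
    (G.induce ({w}ᶜ : Set V)).Reachable u v ↔ AvoidReach G w u v := by
  constructor
  · rw [reachable_iff_reflTransGen]
    intro h
    induction h with
    | refl => exact .refl
    | @tail b c _ h ih => exact .tail ih ⟨h, c.2⟩
  · intro h
    have key : ∀ x : V, AvoidReach G w u x → ∀ hx : x ∈ ({w}ᶜ : Set V),
        (G.induce ({w}ᶜ : Set V)).Reachable u ⟨x, hx⟩ := by
      intro x h
      induction h with
      | refl => exact fun _ => .rfl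
      | @tail b c h₁ h ih =>
        intro hx
        have hb : b ∈ ({w}ᶜ : Set V) := AvoidReach.ne h₁ u.2
        refine (ih hb).trans (Adj.reachable ?_)
        exact h.1
    exact key v h v.2

/-- The inclusion of the complement of a vertex. -/
def inducedHom {V : Type*} (G : SimpleGraph V) (w : V) : G.induce ({w}ᶜ : Set V) →g G where
  toFun := Subtype.val
  map_rel' h := h

/-- Inclusion maps components to components: surjectively once `w` has a neighbor, injectively when
the neighbors of `w` stay connected. -/
theorem isCutVertex_iff {V : Type*} [Finite V] (G : SimpleGraph V) (w : V) :
    IsCutVertex G w ↔ ∃ a b, G.Adj w a ∧ G.Adj w b ∧ ¬ AvoidReach G w a b := by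
  have : Finite G.ConnectedComponent := Quot.finite _
  have : Finite (G.induce ({w}ᶜ : Set V)).ConnectedComponent := Quot.finite _
  let f : (G.induce ({w}ᶜ : Set V)).ConnectedComponent → G.ConnectedComponent :=
    ConnectedComponent.map (inducedHom G w)
  have hf : ∀ x, f (connectedComponentMk _ x) = G.connectedComponentMk x := fun _ => rfl
  unfold IsCutVertex
  constructor
  · intro hlt
    by_contra! hall
    refine absurd hlt (not_lt.2 (Nat.card_le_card_of_injective f ?_))
    intro p q
    induction p using ConnectedComponent.ind with | _ p
    induction q using ConnectedComponent.ind with | _ q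
    rw [hf, hf, ConnectedComponent.eq, ConnectedComponent.eq, reachable_induce_iff,
      reachable_iff_reflTransGen]
    intro h
    -- When the walk is at `w`, keep a neighbor of `w` already reached; `hall` joins it to the next
    -- node.
    have key : ∀ y, ReflTransGen G.Adj p y →
        (y ≠ w ∧ AvoidReach G w p y) ∨ (y = w ∧ ∃ a, G.Adj w a ∧ AvoidReach G w p a) := by
      intro y hy
      induction hy with
      | refl => exact .inl ⟨p.2, .refl⟩
      | @tail b c _ hbc ih =>
        by_cases hc : c = w
        · subst hc
          rcases ih with ih | ih
          · exact .inr ⟨rfl, b, hbc.symm, ih.2⟩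
          · exact absurd ih.1 hbc.ne
        · refine .inl ⟨hc, ?_⟩
          rcases ih with ih | ⟨rfl, a, ha, hpa⟩
          · exact .tail ih.2 ⟨hbc, hc⟩
          · exact hpa.trans (hall a c ha hbc)
    rcases key q h with h | h
    · exact h.2
    · exact absurd h.1 q.2
  · rintro ⟨a, b, ha, hb, hab⟩
    have hsurj : Function.Surjective f := by
      intro y
      induction y using ConnectedComponent.ind with | _ y
      by_cases hy : y = w
      · refine ⟨connectedComponentMk _ ⟨a, ha.ne'⟩, ?_⟩
        rw [hf, ConnectedComponent.eq, hy]
        exact ha.symm.reachable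
      · exact ⟨connectedComponentMk _ ⟨y, hy⟩, hf _⟩
    refine lt_of_le_of_ne (Nat.card_le_card_of_surjective f hsurj) fun hcard => hab ?_
    have hbij := (Nat.bijective_iff_surjective_and_card f).2 ⟨hsurj, hcard.symm⟩
    have := @hbij.1 (connectedComponentMk _ ⟨a, ha.ne'⟩) (connectedComponentMk _ ⟨b, hb.ne'⟩) (by
      rw [hf, hf, ConnectedComponent.eq]
      exact ha.symm.reachable.trans hb.reachable)
    rw [ConnectedComponent.eq, reachable_induce_iff] at this
    exact this

theorem isCutEdge_iff {V : Type*} [Finite V] {G : SimpleGraph V} {a b : V} (hab : G.Adj a b) :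
    IsCutEdge G s(a, b) ↔ ¬ (G.deleteEdges {s(a, b)}).Reachable a b := by
  have : Finite G.ConnectedComponent := Quot.finite _
  have : Finite (G.deleteEdges {s(a, b)}).ConnectedComponent := Quot.finite _
  let f : (G.deleteEdges {s(a, b)}).ConnectedComponent → G.ConnectedComponent :=
    ConnectedComponent.map (Hom.ofLE (deleteEdges_le _))
  have hf : ∀ x, f (connectedComponentMk _ x) = G.connectedComponentMk x := fun _ => rfl
  unfold IsCutEdge
  constructor
  · intro hlt hr
    refine absurd hlt (not_lt.2 (Nat.card_le_card_of_injective f ?_))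
    intro p q
    induction p using ConnectedComponent.ind with | _ p
    induction q using ConnectedComponent.ind with | _ q
    rw [hf, hf, ConnectedComponent.eq, ConnectedComponent.eq, reachable_iff_reflTransGen]
    intro h
    induction h with
    | refl => exact .rfl
    | @tail x y _ h ih =>
      refine ih.trans ?_
      by_cases he : s(x, y) = s(a, b)
      · rcases Sym2.eq_iff.1 he with ⟨rfl, rfl⟩ | ⟨rfl, rfl⟩
        exacts [hr, hr.symm]
      · exact Adj.reachable (deleteEdges_adj.2 ⟨h, he⟩)
  · intro hr
    have hsurj : Function.Surjective f := by
      intro y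
      induction y using ConnectedComponent.ind with | _ y
      exact ⟨connectedComponentMk _ y, hf _⟩
    refine lt_of_le_of_ne (Nat.card_le_card_of_surjective f hsurj) fun hcard => hr ?_
    have hbij := (Nat.bijective_iff_surjective_and_card f).2 ⟨hsurj, hcard.symm⟩
    exact ConnectedComponent.eq.1 (@hbij.1 (connectedComponentMk _ a) (connectedComponentMk _ b)
      (ConnectedComponent.eq.2 hab.reachable))

/-! ### Walks and distances across a cut -/

/-- A walk which avoids `w` after its start, or else splits at `w`. -/
theorem avoidReach_or_exists_split {V : Type*} {G : SimpleGraph V} (w : V) {s r : V}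
    (p : G.Walk s r) : AvoidReach G w s r ∨
      ∃ (q : G.Walk s w) (q' : G.Walk w r), q.length + q'.length = p.length := by
  induction p with
  | nil => exact .inl .refl
  | @cons a b r h p ih =>
    by_cases hb : b = w
    · subst hb
      exact .inr ⟨h.toWalk, p, by simp [add_comm]⟩
    · rcases ih with ih | ⟨q, q', hq⟩
      · exact .inl (.head ⟨h, hb⟩ ih)
      · exact .inr ⟨.cons h q, q', by simp only [Walk.length_cons]; omega⟩

/-- A walk between the two sides of a cut edge traverses it. -/
theorem exists_split_of_not_reachable {V : Type*} {G : SimpleGraph V} {w₁ w₂ : V}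
    {s r : V} (p : G.Walk s r) (hr : (G.deleteEdges {s(w₁, w₂)}).Reachable w₁ r)
    (hs : ¬ (G.deleteEdges {s(w₁, w₂)}).Reachable w₁ s) :
    ∃ (q : G.Walk s w₂) (q' : G.Walk w₁ r), q.length + 1 + q'.length = p.length := by
  induction p with
  | nil => exact absurd hr hs
  | @cons a b r h p ih =>
    by_cases hb : (G.deleteEdges {s(w₁, w₂)}).Reachable w₁ b
    · by_cases he : s(a, b) = s(w₁, w₂)
      · rcases Sym2.eq_iff.1 he with ⟨rfl, rfl⟩ | ⟨rfl, rfl⟩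
        · exact absurd .rfl hs
        · exact ⟨.nil, p, by simp [add_comm]⟩
      · exact absurd (hb.trans (Adj.reachable (deleteEdges_adj.2 ⟨h.symm, by
          rwa [Set.mem_singleton_iff, Sym2.eq_swap]⟩))) hs
    · obtain ⟨q, q', hq⟩ := ih hr hb
      exact ⟨.cons h q, q', by simp only [Walk.length_cons]; omega⟩

theorem dist_add_dist_le_of_not_reachable {V : Type*} {G : SimpleGraph V} {w₁ w₂ s r : V}
    (h : G.Reachable s r) (hr : (G.deleteEdges {s(w₁, w₂)}).Reachable w₁ r)
    (hs : ¬ (G.deleteEdges {s(w₁, w₂)}).Reachable w₁ s) :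
    G.dist s w₂ + 1 + G.dist w₁ r ≤ G.dist s r := by
  obtain ⟨p, hp⟩ := h.exists_walk_length_eq_dist
  obtain ⟨q, q', hq⟩ := exists_split_of_not_reachable p hr hs
  have := dist_le q
  have := dist_le q'
  omega

theorem dist_le_succ_of_adj {V : Type*} {G : SimpleGraph V} {a b r : V} (hab : G.Adj a b)
    (h : G.Reachable b r) : G.dist a r ≤ G.dist b r + 1 := by
  obtain ⟨p, hp⟩ := h.exists_walk_length_eq_dist
  have := dist_le (Walk.cons hab p)
  rw [Walk.length_cons] at this
  omega

/-! ### Stable colorings -/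

namespace StableColoring

variable {V W C : Type*} {G : SimpleGraph V} {H : SimpleGraph W}
  {c : V → V → C} {d : W → W → C} {A : V → C} {B : W → C}

/-- Steps lift one at a time; the mark forces the lifted walk to end at `r'`. -/
theorem exists_walk (S : StableColoring G H c d A B) {s r : V} (p : G.Walk s r) {s' r' : W}
    (h : c r s = d r' s') : (∃ q : H.Walk s' r', q.length = p.length) ∧ c r r = d r' r' := by
  induction p generalizing s' with
  | nil =>
    obtain rfl := (S.mark h).1 rfl
    exact ⟨⟨.nil, rfl⟩, h⟩
  | cons hab p ih =>
    obtain ⟨b', hb', hc⟩ := S.lift h hab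
    obtain ⟨⟨q, hq⟩, h'⟩ := ih hc
    exact ⟨⟨.cons hb' q, by simp [hq]⟩, h'⟩

/-- The color of a node determines the distances to the nodes of each color. -/
theorem exists_dist_eq (S : StableColoring G G c c A A) {s w r : V} (h : A s = A w)
    (hr : G.Reachable s r) : ∃ r', A r' = A r ∧ G.Reachable w r' ∧ G.dist w r' = G.dist s r := by
  obtain ⟨r', h'⟩ := S.row h r
  obtain ⟨p, hp⟩ := hr.exists_walk_length_eq_dist
  obtain ⟨⟨q, hq⟩, hrr⟩ := S.exists_walk p h'
  refine ⟨r', (S.glob hrr).symm, q.reachable, le_antisymm ?_ ?_⟩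
  · exact (dist_le q).trans (hq.trans hp).le
  · obtain ⟨q', hq'⟩ := q.reachable.exists_walk_length_eq_dist
    obtain ⟨⟨p', hp'⟩, -⟩ := S.exists_walk q' h'.symm
    exact (dist_le p').trans (hp'.trans hq').le

/-! ### Cut vertices -/

/-- At a cut vertex, all but one of the sides contain no other vertex of the same color. -/
theorem forall_ne_or_forall_ne [Finite V] (S : StableColoring G G c c A A) {w a b : V}
    (ha : G.Adj w a) (hb : G.Adj w b) (hab : ¬ AvoidReach G w a b) :
    (∀ r, AvoidReach G w a r → A r ≠ A w) ∨ (∀ r, AvoidReach G w b r → A r ≠ A w) := by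
  by_contra! hcon
  obtain ⟨⟨ra, hra, hAra⟩, rb, hrb, hArb⟩ := hcon
  obtain ⟨r, ⟨hAr, hwr⟩, hmax⟩ := Set.exists_max_image {r | A r = A w ∧ G.Reachable w r}
    (fun r => G.dist w r) (Set.toFinite _) ⟨w, rfl, .rfl⟩
  -- Since `y` is colored like `w`, `dist y r ≤ dist w r`; a shortest walk from `y` through `w`
  -- would be too long. So `r` lies on the side of `y`, hence on both sides.
  have key : ∀ {x y : V}, G.Adj w x → AvoidReach G w x y → A y = A w → AvoidReach G w x r := by
    intro x y hx hxy hy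
    have hwy : G.Reachable w y := hx.reachable.trans hxy.reachable
    obtain ⟨r', hAr', hwr', hd⟩ := S.exists_dist_eq hy (hwy.symm.trans hwr)
    have hle := hmax r' ⟨hAr'.trans hAr, hwr'⟩
    obtain ⟨p, hp⟩ := (hwy.symm.trans hwr).exists_walk_length_eq_dist
    rcases avoidReach_or_exists_split w p with h | ⟨q, q', hq⟩
    · exact hxy.trans h
    · have h₁ := dist_le q'
      have h₂ : 0 < q.length := by
        rw [Nat.pos_iff_ne_zero]
        exact fun h0 => hxy.ne hx.ne' (Walk.eq_of_length_eq_zero h0)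
      omega
  have h₁ := key ha hra hAra
  have h₂ := key hb hrb hArb
  exact hab (h₁.trans (h₂.symm hb.ne'))

theorem isCutVertex [Finite V] [Finite W] (S : StableColoring G H c d A B)
    (S' : StableColoring H G d c B A) (SG : StableColoring G G c c A A) {w : V} {x : W}
    (hwx : A w = B x) (hw : IsCutVertex G w) : IsCutVertex H x := by
  rw [isCutVertex_iff] at hw ⊢
  have main : ∀ {u b : V}, G.Adj w u → G.Adj w b → ¬ AvoidReach G w u b →
      (∀ r, AvoidReach G w u r → A r ≠ A w) →
      ∃ a b, H.Adj x a ∧ H.Adj x b ∧ ¬ AvoidReach H x a b := by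
    intro u b hu hb hub hR
    obtain ⟨u', hu'⟩ := S.row hwx u
    obtain ⟨u'', hxu, hc⟩ := S.lift hu' hu
    obtain rfl := (S.mark hc).1 rfl
    obtain ⟨b', hxb, hcb⟩ := S.lift hu' hb
    refine ⟨u'', b', hxu, hxb, fun hreach => hub ?_⟩
    have huniq := S.uniq (k := A w) hc (by
      have : ∀ y, G.Adj u y → A y = A w → y = w := by
        intro y hy hAy
        by_contra hne
        exact hR y (.single ⟨hy, hne⟩) hAy
      intro y₁ y₂ h₁ h₂ h₃ h₄
      rw [this y₁ h₁ h₃, this y₂ h₂ h₄])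
    have hlift : ∀ v', AvoidReach H x u'' v' → ∃ v, AvoidReach G w u v ∧ c u v = d u'' v' := by
      intro v' h
      induction h with
      | refl => exact ⟨u, .refl, hc⟩
      | @tail p p' _ h ih =>
        obtain ⟨q, hq, hqp⟩ := ih
        obtain ⟨q', hqq, hq'⟩ := S'.lift hqp.symm h.1
        refine ⟨q', hq.tail ⟨hqq, ?_⟩, hq'.symm⟩
        -- If the lift hit `w`, then `p'` would be a neighbor of `u''` colored like `x`, hence `x`
        -- itself.
        rintro rfl
        obtain ⟨z, hz, hcz⟩ := S.lift hq'.symm hu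
        obtain rfl := (S.mark hcz).1 rfl
        exact h.2 (huniq _ _ hz.symm hxu.symm (S.glob hq'.symm).symm hwx.symm)
    obtain ⟨q, hq, hqb⟩ := hlift b' hreach
    -- The lift ends at a node `q` colored like `b`, perhaps not at `b`. Mirroring its walk back to
    -- `u` shows that `b` is on the side of `u` too.
    have hback : ∀ q, AvoidReach G w u q → ∀ y, c u q = c u y → AvoidReach G w u y := by
      intro q h
      induction h with
      | refl =>
        intro y hy
        rw [(SG.mark hy).1 rfl]
        exact .refl
      | @tail q q' h₁ h ih =>
        intro y hy
        obtain ⟨z, hz, hcz⟩ := SG.lift hy h.1.symm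
        refine (ih z hcz).tail ⟨hz.symm, ?_⟩
        rintro rfl
        exact hR q' (.tail h₁ h) (SG.glob hy)
    exact hback q hq b (hqb.trans hcb.symm)
  obtain ⟨a, b, ha, hb, hab⟩ := hw
  rcases SG.forall_ne_or_forall_ne ha hb hab with h | h
  · exact main ha hb hab h
  · exact main hb ha (fun h' => hab (h'.symm hb.ne')) h

/-! ### Cut edges -/

/-- Of the two sides of a cut edge, one has no further vertex with the color of the opposite
endpoint. -/
theorem forall_eq_or_forall_eq [Finite V] (S : StableColoring G G c c A A) {w₁ w₂ : V}
    (hw : G.Adj w₁ w₂) (hcut : ¬ (G.deleteEdges {s(w₁, w₂)}).Reachable w₁ w₂) :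
    (∀ r, (G.deleteEdges {s(w₁, w₂)}).Reachable w₁ r → A r = A w₂ → r = w₁) ∨
    (∀ r, (G.deleteEdges {s(w₁, w₂)}).Reachable w₂ r → A r = A w₁ → r = w₂) := by
  by_contra! hcon
  obtain ⟨⟨a, hwa, hAa, hne_a⟩, b, hwb, hAb, hne_b⟩ := hcon
  have hle : G.deleteEdges {s(w₁, w₂)} ≤ G := deleteEdges_le _
  have hga : G.Reachable w₁ a := hwa.mono hle
  have hgb : G.Reachable w₂ b := hwb.mono hle
  -- Let `M = dist y z` be the largest distance between nodes colored like `w₁` and `w₂` in this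
  -- component.
  obtain ⟨⟨y, z⟩, ⟨hAy, hAz, hy, hz⟩, hmax⟩ := Set.exists_max_image
    {p : V × V | A p.1 = A w₁ ∧ A p.2 = A w₂ ∧ G.Reachable w₁ p.1 ∧ G.Reachable w₁ p.2}
    (fun p => G.dist p.1 p.2) (Set.toFinite _) ⟨(w₁, w₂), rfl, rfl, .rfl, hw.reachable⟩
  simp only at hAy hAz hy hz
  replace hmax : ∀ p q, A p = A w₁ → A q = A w₂ → G.Reachable w₁ p → G.Reachable w₁ q →
      G.dist p q ≤ G.dist y z := fun p q h₁ h₂ h₃ h₄ => hmax (p, q) ⟨h₁, h₂, h₃, h₄⟩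
  have hside : ∀ r, (G.deleteEdges {s(w₁, w₂)}).Reachable w₂ r →
      ¬ (G.deleteEdges {s(w₁, w₂)}).Reachable w₁ r := fun r h h' => hcut (h'.trans h.symm)
  have hside' : ∀ r, G.Reachable w₁ r → ¬ (G.deleteEdges {s(w₁, w₂)}).Reachable w₁ r →
      (G.deleteEdges {s(w₁, w₂)}).Reachable w₂ r := by
    intro r hr hn
    obtain ⟨p⟩ := hr.symm
    by_contra hn'
    rw [Sym2.eq_swap] at hn hn'
    have key : ∀ {s t : V}, G.Walk s t → (t = w₁) →
        (G.deleteEdges {s(w₂, w₁)}).Reachable w₁ s ∨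
        (G.deleteEdges {s(w₂, w₁)}).Reachable w₂ s := by
      intro s t p ht
      induction p with
      | nil => exact .inl (ht ▸ .rfl)
      | @cons s s' t h p ih =>
        by_cases he : s(s, s') = s(w₂, w₁)
        · rcases Sym2.eq_iff.1 he with ⟨rfl, rfl⟩ | ⟨rfl, rfl⟩
          exacts [.inr .rfl, .inl .rfl]
        · have : (G.deleteEdges {s(w₂, w₁)}).Reachable s s' :=
            Adj.reachable (deleteEdges_adj.2 ⟨h, he⟩)
          exact (ih ht).imp (·.trans this.symm) (·.trans this.symm)
    exact (key p rfl).elim hn hn'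
  -- The largest distance is attained from `w₁` and from `w₂`.
  obtain ⟨z', hAz', hz', hdz⟩ := S.exists_dist_eq hAy (hy.symm.trans hz)
  obtain ⟨y', hAy', hy', hdy⟩ := S.exists_dist_eq hAz (hz.symm.trans hy)
  rw [hAz] at hAz'
  rw [hAy] at hAy'
  rw [SimpleGraph.dist_comm (u := z)] at hdy
  have hgy' : G.Reachable w₁ y' := hw.reachable.trans hy'
  have hgb' : G.Reachable w₁ b := hw.reachable.trans hgb
  -- Otherwise `b`, colored like `w₁`, would be farther than `M` from `z'`.
  have hz'B : ¬ (G.deleteEdges {s(w₁, w₂)}).Reachable w₁ z' := by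
    intro h
    have h₁ := dist_add_dist_le_of_not_reachable (hgb'.symm.trans hz') h (hside b hwb)
    have h₂ := hmax b z' hAb hAz' hgb' hz'
    omega
  have hy'A : (G.deleteEdges {s(w₁, w₂)}).Reachable w₁ y' := by
    by_contra h
    have h₁ := dist_add_dist_le_of_not_reachable (w₁ := w₂) (w₂ := w₁) (hga.symm.trans hgy')
      (by rw [Sym2.eq_swap]; exact hside' y' hgy' h)
      (by rw [Sym2.eq_swap]; exact fun h => hside a h hwa)
    have h₂ := hmax y' a hAy' hAa hgy' hga
    rw [SimpleGraph.dist_comm] at h₂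
    omega
  -- Both `dist w₂ z'` and `dist w₁ y'` are at least `M - 1`, so `M ≥ 2 * M - 1` and `M ≤ 1`. But `M
  -- ≥ dist b a ≥ 2`, as `a ≠ w₁`.
  have h₁ := dist_add_dist_le_of_not_reachable (hz'.symm.trans hgy') hy'A hz'B
  have h₂ := hmax y' z' hAy' hAz' hgy' hz'
  have h₃ := dist_le_succ_of_adj hw (hw.reachable.symm.trans hz')
  have h₄ := dist_le_succ_of_adj hw.symm hgy'
  have h₅ := dist_add_dist_le_of_not_reachable (hgb'.symm.trans hga) hwa (hside b hwb)
  have h₆ := hmax b a hAb hAa hgb' hga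
  have h₇ := hga.pos_dist_of_ne (Ne.symm hne_a)
  have h₈ : G.dist z' y' = G.dist y' z' := SimpleGraph.dist_comm
  have h₉ : G.dist z' w₂ = G.dist w₂ z' := SimpleGraph.dist_comm
  have h₁₀ : G.dist w₁ y' = G.dist y' w₁ := SimpleGraph.dist_comm
  omega

theorem not_reachable_of_forall_eq (S : StableColoring G H c d A B)
    (S' : StableColoring H G d c B A) {w₁ w₂ : V} {x₁ x₂ : W} (hw : G.Adj w₁ w₂)
    (hx : H.Adj x₁ x₂) (h₁ : A w₁ = B x₁) (h₂ : A w₂ = B x₂)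
    (hcut : ¬ (G.deleteEdges {s(w₁, w₂)}).Reachable w₁ w₂)
    (hR : ∀ r, (G.deleteEdges {s(w₁, w₂)}).Reachable w₁ r → A r = A w₂ → r = w₁) :
    ¬ (H.deleteEdges {s(x₁, x₂)}).Reachable x₁ x₂ := by
  intro hreach
  obtain ⟨u', hu'⟩ := S.row h₁ w₁
  obtain rfl := (S.mark hu').1 rfl
  have huniq := S.uniq (k := A w₂) hu' (by
    have : ∀ y, G.Adj w₁ y → A y = A w₂ → y = w₂ := by
      intro y hy hAy
      by_contra hne
      refine hy.ne' (hR y (Adj.reachable (deleteEdges_adj.2 ⟨hy, ?_⟩)) hAy)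
      rw [Set.mem_singleton_iff, Sym2.eq_iff]
      rintro (h | h)
      · exact hne h.2
      · exact hw.ne h.1
    intro y₁ y₂ h₁ h₂ h₃ h₄
    rw [this y₁ h₁ h₃, this y₂ h₂ h₄])
  have hlift : ∀ v', (H.deleteEdges {s(x₁, x₂)}).Reachable x₁ v' →
      ∃ v, (G.deleteEdges {s(w₁, w₂)}).Reachable w₁ v ∧ c w₁ v = d x₁ v' := by
    intro v' h
    rw [reachable_iff_reflTransGen] at h
    induction h with
    | refl => exact ⟨w₁, .rfl, hu'⟩
    | @tail p p' _ h ih =>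
      obtain ⟨q, hq, hqp⟩ := ih
      obtain ⟨hpp, hne⟩ := deleteEdges_adj.1 h
      obtain ⟨q', hqq, hq'⟩ := S'.lift hqp.symm hpp
      refine ⟨q', ?_, hq'.symm⟩
      by_cases he : s(q, q') = s(w₁, w₂)
      · rcases Sym2.eq_iff.1 he with ⟨rfl, rfl⟩ | ⟨rfl, rfl⟩
        -- A lifted step from `w₁` to `w₂` comes from a step from `x₁` to its only neighbor of that
        -- color, `x₂`: the deleted edge.
        · obtain rfl := (S.mark hqp).1 rfl
          refine absurd ?_ hne
          rw [huniq p' x₂ hpp hx (S.glob hq'.symm).symm h₂.symm]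
          rfl
        · exact absurd hq hcut
      · exact hq.trans (Adj.reachable (deleteEdges_adj.2 ⟨hqq, he⟩))
  obtain ⟨q, hq, hqx⟩ := hlift x₂ hreach
  -- On this side only `w₁` can be colored like `w₂`, so `q = w₁`, and the mark forces `x₂ = x₁`.
  exact hx.ne' ((S.mark hqx).1 (hR q hq ((S.glob hqx).trans h₂.symm)))

theorem isCutEdge [Finite V] [Finite W] (S : StableColoring G H c d A B)
    (S' : StableColoring H G d c B A) (SG : StableColoring G G c c A A) {w₁ w₂ : V} {x₁ x₂ : W}
    (hw : G.Adj w₁ w₂) (hx : H.Adj x₁ x₂) (h₁ : A w₁ = B x₁) (h₂ : A w₂ = B x₂)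
    (hcut : IsCutEdge G s(w₁, w₂)) : IsCutEdge H s(x₁, x₂) := by
  rw [isCutEdge_iff hw] at hcut
  rcases SG.forall_eq_or_forall_eq hw hcut with h | h
  · exact (isCutEdge_iff hx).2 (S.not_reachable_of_forall_eq S' hw hx h₁ h₂ hcut h)
  · rw [Sym2.eq_swap, isCutEdge_iff hx.symm]
    rw [Sym2.eq_swap] at h hcut
    exact S.not_reachable_of_forall_eq S' hw.symm hx.symm h₂ h₁ (fun h' => hcut h'.symm) h

end StableColoring

/-! ### The colors of DSS-WL -/

theorem eq_and_eq_or_of_pair_eq {C : Type*} {a b x y : C} (h : ({a, b} : Multiset C) = {x, y}) :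
    (a = x ∧ b = y) ∨ (a = y ∧ b = x) := by
  rcases Multiset.cons_eq_cons.1 h with ⟨h₁, h₂⟩ | ⟨-, cs, h₁, h₂⟩
  · exact .inl ⟨h₁, Multiset.singleton_inj.1 h₂⟩
  · exact .inr ⟨((Multiset.singleton_eq_cons_iff _).1 h₂).1.symm,
      ((Multiset.singleton_eq_cons_iff _).1 h₁).1⟩

section DSSColors

variable {V W C : Type*} [Fintype V] [Fintype W]

theorem mem_nbrColors {G : SimpleGraph V} {χ : V → C} {v : V} {k : C} :
    k ∈ nbrColors G χ v ↔ ∃ w, G.Adj v w ∧ χ w = k := by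
  simp [nbrColors]

open Classical in
theorem count_nbrColors_le_one_iff {G : SimpleGraph V} {χ : V → C} {v : V} {k : C} :
    (nbrColors G χ v).count k ≤ 1 ↔
      ∀ w₁ w₂, G.Adj v w₁ → G.Adj v w₂ → χ w₁ = k → χ w₂ = k → w₁ = w₂ := by
  rw [nbrColors, Multiset.count_map, ← Finset.filter_val, Finset.card_val, Finset.card_le_one]
  simp only [Finset.mem_filter, Finset.mem_univ, true_and]
  exact ⟨fun h w₁ w₂ h₁ h₂ h₃ h₄ => h _ ⟨h₁, h₃.symm⟩ _ ⟨h₂, h₄.symm⟩,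
    fun h w₁ h₁ w₂ h₂ => h _ _ h₁.1 h₂.1 h₁.2.symm h₂.2.symm⟩

theorem init_eq_of_dssSubColor_eq {ι κ : Type*} [Fintype ι] [Fintype κ] {hash : HashArg C → C}
    (hash_inj : Function.Injective hash) {G : SimpleGraph V} {H : SimpleGraph W}
    {A : GraphBag V C ι} {B : GraphBag W C κ} {t : ℕ} {i : ι} {j : κ} {v : V} {v' : W}
    (h : dssSubColor hash G A t i v = dssSubColor hash H B t j v') :
    A.init i v = B.init j v' := by
  induction t with
  | zero => exact h
  | succ t ih => exact ih (HashArg.tuple.inj (hash_inj h)).1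

/-- Pairs equally colored at round `T` remain so at `T + 1`, and injectivity of `hash` then exposes
the data of round `T`. -/
theorem stableColoring_dssSubColor {hash : HashArg C → C} (hash_inj : Function.Injective hash)
    {c₀ c₁ : C} (hc : c₀ ≠ c₁) {G : SimpleGraph V} {H : SimpleGraph W} {T : ℕ}
    (hT : ∀ u v u' v', dssSubColor hash G (nodeMarking c₀ c₁ G) T u v =
        dssSubColor hash H (nodeMarking c₀ c₁ H) T u' v' →
      dssSubColor hash G (nodeMarking c₀ c₁ G) (T + 1) u v =
        dssSubColor hash H (nodeMarking c₀ c₁ H) (T + 1) u' v') :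
    StableColoring G H (dssSubColor hash G (nodeMarking c₀ c₁ G) T)
      (dssSubColor hash H (nodeMarking c₀ c₁ H) T)
      (dssColor hash G (nodeMarking c₀ c₁ G) T) (dssColor hash H (nodeMarking c₀ c₁ H) T) where
  mark {u v u' v'} h := by
    have := init_eq_of_dssSubColor_eq hash_inj h
    simp only [nodeMarking] at this
    split_ifs at this with h₁ h₂ h₂
    · simp [h₁, h₂]
    · exact absurd this.symm hc
    · exact absurd this hc
    · simp [h₁, h₂]
  glob h := (HashArg.tuple.inj (hash_inj (hT _ _ _ _ h))).2.2.1
  lift {u v u' v' w} h hw := by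
    have := (HashArg.tuple.inj (hash_inj (hT _ _ _ _ h))).2.1
    have hmem := (mem_nbrColors (χ := dssSubColor hash G (nodeMarking c₀ c₁ G) T u)).2 ⟨w, hw, rfl⟩
    obtain ⟨w', hw', h'⟩ := mem_nbrColors.1 (this ▸ hmem)
    exact ⟨w', hw', h'.symm⟩
  row {v v'} h u := by
    have h' := HashArg.multiset.inj (hash_inj h)
    have hmem := Multiset.mem_map_of_mem
      (fun i => dssSubColor hash G (nodeMarking c₀ c₁ G) T i v) (Finset.mem_univ_val u)
    rw [h', Multiset.mem_map] at hmem
    obtain ⟨u', -, hu'⟩ := hmem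
    exact ⟨u', hu'.symm⟩
  uniq {u v u' v' k} h hu := by
    classical
    have := (HashArg.tuple.inj (hash_inj (hT _ _ _ _ h))).2.2.2
    rw [← count_nbrColors_le_one_iff] at hu ⊢
    exact (congrArg (Multiset.count k) this).symm.trans_le hu

/-- The set of separated pairs only grows, inside a finite set, so it is eventually constant. -/
theorem exists_forall_ge_dssStable {ι κ : Type*} [Fintype ι] [Fintype κ] {hash : HashArg C → C}
    (hash_inj : Function.Injective hash) (G : SimpleGraph V) (A : GraphBag V C ι)
    (H : SimpleGraph W) (B : GraphBag W C κ) :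
    ∃ T₀ : ℕ, ∀ T ≥ T₀, DSSStable hash G A H B T := by
  let f : ℕ → Set (((ι × V) ⊕ (κ × W)) × ((ι × V) ⊕ (κ × W))) := fun t =>
    {p | dssJointColor hash G A H B t p.1 ≠ dssJointColor hash G A H B t p.2}
  have hf : Monotone f := by
    refine monotone_nat_of_le_succ fun t p hp h => hp ?_
    rcases p with ⟨p | p, q | q⟩ <;> exact (HashArg.tuple.inj (hash_inj h)).1
  obtain ⟨n, hn⟩ := WellFoundedGT.monotone_chain_condition ⟨f, hf⟩
  refine ⟨n, fun T hT p q hpq => ?_⟩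
  by_contra hne
  have h : (p, q) ∈ f (T + 1) := hne
  have hfT : f n = f T := hn T hT
  have hfT' : f n = f (T + 1) := hn (T + 1) (by omega)
  rw [← hfT', hfT] at h
  exact h hpq

end DSSColors

theorem theorem3p2 {V W C : Type*} [Fintype V] [Fintype W]
    (G : SimpleGraph V) (H : SimpleGraph W)
    (hash : HashArg C → C) (hash_inj : Function.Injective hash)
    (c₀ c₁ : C) (hc : c₀ ≠ c₁) :
    (∃ T₀ : ℕ, ∀ T ≥ T₀, DSSStable hash G (nodeMarking c₀ c₁ G) H (nodeMarking c₀ c₁ H) T) ∧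
    ∀ T : ℕ, DSSStable hash G (nodeMarking c₀ c₁ G) H (nodeMarking c₀ c₁ H) T →
      (∀ (w : V) (x : W),
        dssColor hash G (nodeMarking c₀ c₁ G) T w = dssColor hash H (nodeMarking c₀ c₁ H) T x →
        (IsCutVertex G w ↔ IsCutVertex H x)) ∧
      (∀ (w₁ w₂ : V) (x₁ x₂ : W), G.Adj w₁ w₂ → H.Adj x₁ x₂ →
        ({dssColor hash G (nodeMarking c₀ c₁ G) T w₁,
          dssColor hash G (nodeMarking c₀ c₁ G) T w₂} : Multiset C) =
        {dssColor hash H (nodeMarking c₀ c₁ H) T x₁,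
          dssColor hash H (nodeMarking c₀ c₁ H) T x₂} →
        (IsCutEdge G s(w₁, w₂) ↔ IsCutEdge H s(x₁, x₂))) := by
  refine ⟨exists_forall_ge_dssStable hash_inj G _ H _, fun T hT => ?_⟩
  have S := stableColoring_dssSubColor hash_inj hc (G := G) (H := H) (T := T)
    fun u v u' v' h => hT (.inl (u, v)) (.inr (u', v')) h
  have S' := stableColoring_dssSubColor hash_inj hc (G := H) (H := G) (T := T)
    fun u v u' v' h => hT (.inr (u, v)) (.inl (u', v')) h
  -- Joint stability also compares each graph with itself, as the distance arguments require.
  have SG := stableColoring_dssSubColor hash_inj hc (G := G) (H := G) (T := T)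
    fun u v u' v' h => hT (.inl (u, v)) (.inl (u', v')) h
  have SH := stableColoring_dssSubColor hash_inj hc (G := H) (H := H) (T := T)
    fun u v u' v' h => hT (.inr (u, v)) (.inr (u', v')) h
  refine ⟨fun w x h => ⟨S.isCutVertex S' SG h, S'.isCutVertex S SH h.symm⟩,
    fun w₁ w₂ x₁ x₂ hw hx h => ?_⟩
  have key : ∀ {y₁ y₂ : W}, H.Adj y₁ y₂ →
      dssColor hash G (nodeMarking c₀ c₁ G) T w₁ = dssColor hash H (nodeMarking c₀ c₁ H) T y₁ →
      dssColor hash G (nodeMarking c₀ c₁ G) T w₂ = dssColor hash H (nodeMarking c₀ c₁ H) T y₂ →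
      (IsCutEdge G s(w₁, w₂) ↔ IsCutEdge H s(y₁, y₂)) := fun hy h₁ h₂ =>
    ⟨S.isCutEdge S' SG hw hy h₁ h₂, S'.isCutEdge S SH hy hw h₁.symm h₂.symm⟩
  rcases eq_and_eq_or_of_pair_eq h with h | h
  · exact key hx h.1 h.2
  · rw [Sym2.eq_swap (a := x₁)]
    exact key hx.symm h.1 h.2
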